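/- **Setting.** Let $\Phi:\mathbb R^N\to\mathbb R^Q$ be linear and $J:\mathbb R^N\to\mathbb R$ finite-valued and convex. For $x\in\mathbb R^N$ let $S_x$ be the linear subspace parallel to the affine hull of $\partial J(x)$, $T_x=S_x^\perp$ the model subspace, and $e_x$ the orthogonal projection of $0$ onto the affine hull of $\partial J(x)$. For $f_x$ in the relative interior $\operatorname{ri}\partial J(x)$ let $J_{f_x}$ be the gauge of the convex set $\partial J(x)-f_x$ (it is finite exactly on $S_x$). $P_V$ is the orthogonal projector onto a subspace $V$, $\Phi_V=\Phi P_V$, $A^*$ the adjoint and $A^+$ the Moore–Penrose pseudo-inverse of $A$, $A^{+,*}=(A^+)^*$, and $\|\cdot\|$ the Euclidean norm. Fix $x_0\in\mathbb R^N$ and write $T=T_{x_0}$, $S=S_{x_0}$. Assume that $J$ is *partly smooth at $x_0$ relative to the linear manifold $T$ with parameters $(\Gamma,f,\nu,\mu,\tau,\xi)$*, which means the following. 1. $x_0\in T$, the restriction of $J$ to $T$ is $C^2$ around $x_0$, and the set-valued map $\partial J$ is continuous at $x_0$ and Lipschitz-continuous (in Hausdorff distance) around $x_0$, both relative to $T$.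 2. $\Gamma$ is the gauge of a closed convex set containing $0$, and it is finite and coercive on $T$. The map $x\mapsto f_x$ on $T$ satisfies $f_x\in\operatorname{ri}\partial J(x)$ for every $x\in T$ and is Lipschitz-continuous around $x_0$ relative to $T$. 3. $\nu,\mu,\tau,\xi\ge 0$. For all $x'\in T$ with $\Gamma(x_0-x')\le\nu$ one has $T_{x'}=T$. For all $x'\in T$ with $\Gamma(x_0-x')<\nu$ one has $$\Gamma(e_{x_0}-e_{x'})\le\mu\,\Gamma(x_0-x'),\qquad J_{f_{x_0}}\big(P_S(f_{x_0}-f_{x'})\big)\le\tau\,\Gamma(x_0-x'),\qquad \sup_{u\in S,\,u\ne0}\frac{J_{f_{x'}}(u)-J_{f_{x_0}}(u)}{J_{f_{x_0}}(u)}\le\xi\,\Gamma(x_0-x').$$ Assume moreover that $\operatorname{Ker}\Phi\cap T=\{0\}$ and that $$\mathrm{IC}(x_0)=J_{f_{x_0}}\big(\Phi_S^*\Phi_T^{+,*}e_{x_0}-P_Sf_{x_0}\big)<1 .$$ **Theorem 5.1.** There are constants $A_T,B_T,D_T,E_T,M>0$, depending only on $\Phi$, $T$, $\Gamma$, $e_{x_0}$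 and the set $\partial J(x_0)-f_{x_0}$ (equivalently, the gauge $J_{f_{x_0}}$), and in particular not on $\nu,\mu,\tau,\xi,\mathrm{IC}(x_0),w,\lambda$, such that the following holds. Put $$C(x_0)=\frac{1-\mathrm{IC}(x_0)}{\xi\,\nu}\,H\!\left(\frac{D_T\,\mu+\tau}{\xi}\right),\qquad H(\beta)=\frac{\beta+1/2}{E_T\,\beta}\,\varphi\!\left(\frac{2\beta}{(\beta+1)^2}\right),\qquad \varphi(u)=\sqrt{1+u}-1,$$ extended by continuity: $H(0)=\frac1{2E_T}$; if $\xi=0<D_T\mu+\tau$ then $C(x_0)=\frac{1-\mathrm{IC}(x_0)}{\nu E_T(D_T\mu+\tau)}$; if $\xi=\mu=\tau=0$ then $C(x_0)=+\infty$. If $w\in\mathbb R^Q$ and $\lambda>0$ satisfy $$\frac{A_T}{1-\mathrm{IC}(x_0)}\,\|w\|\le\lambda\le\nu\,\min\big(B_T,\,C(x_0)\big),$$ then the problem $$\min_{x\in\mathbb R^N}\ \tfrac12\|y-\Phi x\|^2+\lambda J(x),\qquad y=\Phi x_0+w,$$ has exactly one solution $\hat x$, and it satisfies $T_{\hat x}=T$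 and $\|x_0-\hat x\|\le M\max(\|w\|,\lambda)$. -/

import Mathlib

namespace PartlySmooth

open Filter Topology

noncomputable section

section Convex

variable {E : Type*} [NormedAddCommGroup E] [InnerProductSpace ℝ E]

/-- The subdifferential `∂J(x)` of a finite-valued function `J`. -/
def subdifferential (J : E → ℝ) (x : E) : Set E :=
  {u | ∀ y, J x + inner ℝ u (y - x) ≤ J y}

/-- The subspace `S_x` parallel to the affine hull of `∂J(x)`. -/
def parallelSubspace (J : E → ℝ) (x : E) : Submodule ℝ E :=
  (affineSpan ℝ (subdifferential J x)).direction

/-- The model subspace `T_x = (S_x)ᗮ`. -/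
def modelSubspace (J : E → ℝ) (x : E) : Submodule ℝ E :=
  (parallelSubspace J x)ᗮ

/-- The set `∂J(x) - f`. When `f` lies in the relative interior of `∂J(x)`, its Minkowski gauge is
the subdifferential gauge; that gauge is finite exactly on `S_x`, and Mathlib's real-valued `gauge`
is used below on vectors of `S_x` only. -/
def shiftedSubdifferential (J : E → ℝ) (x f : E) : Set E :=
  {v | f + v ∈ subdifferential J x}

/-- The gauge of `C` is a gauge (of a closed convex set containing the origin) which is finite and
coercive on the subspace `T`. -/
structure IsFiniteCoerciveGaugeOn (C : Set E) (T : Submodule ℝ E) : Prop where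
  closed : IsClosed C
  convex : Convex ℝ C
  zero_mem : (0 : E) ∈ C
  finite : ∀ y ∈ T, ∃ r : ℝ, 0 < r ∧ ∃ c ∈ C, y = r • c
  coercive : Tendsto (fun y : T => gauge C (y : E)) (Bornology.cobounded T) atTop

/-- The finite-valued function `J` is partly smooth at `x` relative to the linear manifold `M`
(whose tangent space at each of its points is `M` itself). Since subdifferentials of finite convex
functions are nonempty and compact, their continuity is expressed by the Hausdorff distance. -/
structure IsPartlySmoothAt (J : E → ℝ) (x : E) (M : Submodule ℝ E) : Prop where
  mem : x ∈ M
  smooth : ContDiffAt ℝ 2 (fun z : M => J (z : E)) ⟨x, mem⟩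
  sharp : M = modelSubspace J x
  continuous : Tendsto (fun z => Metric.hausdorffEDist (subdifferential J z) (subdifferential J x))
    (𝓝[(M : Set E)] x) (𝓝 0)

variable [FiniteDimensional ℝ E]

open Classical in
/-- The vector `e_x`: the orthogonal projection of `0` onto the affine hull of `∂J(x)`
(`0` by convention if `∂J(x)` is empty, which does not happen for a finite convex `J`). -/
def minNormVector (J : E → ℝ) (x : E) : E :=
  if h : Nonempty (affineSpan ℝ (subdifferential J x)) then
    haveI := h
    (EuclideanGeometry.orthogonalProjection (affineSpan ℝ (subdifferential J x)) (0 : E) : E)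
  else 0

/-- `J` is finite-valued, convex and partly smooth at `x` relative to its model subspace `T_x`,
`∂J` is Lipschitz-continuous around `x` relative to `T_x`, with parameters
`(Γ, f, ν, μ, τ, ξ)`, where `Γ` is the gauge of `C`. The selection `f` of the relative interiors
of the subdifferentials is required to be Lipschitz around `x` relative to `T_x`, and only its
values on `T_x` matter. -/
structure IsPSFL (J : E → ℝ) (x : E) (C : Set E) (f : E → E) (ν μ τ ξ : ℝ) : Prop where
  convex : ConvexOn ℝ Set.univ J
  partlySmooth : IsPartlySmoothAt J x (modelSubspace J x)
  lipschitz : ∃ L : NNReal, ∃ U ∈ 𝓝 x, ∀ y ∈ U, ∀ z ∈ U,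
    y ∈ modelSubspace J x → z ∈ modelSubspace J x →
      Metric.hausdorffEDist (subdifferential J y) (subdifferential J z) ≤ L * edist y z
  gauge_spec : IsFiniteCoerciveGaugeOn C (modelSubspace J x)
  sel_mem : ∀ y ∈ modelSubspace J x, f y ∈ intrinsicInterior ℝ (subdifferential J y)
  sel_lipschitz : ∃ L : NNReal, ∃ U ∈ 𝓝 x, LipschitzOnWith L f (U ∩ modelSubspace J x)
  nu_nonneg : 0 ≤ ν
  mu_nonneg : 0 ≤ μ
  tau_nonneg : 0 ≤ τ
  xi_nonneg : 0 ≤ ξ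
  nu_stable : ∀ y ∈ modelSubspace J x, gauge C (x - y) ≤ ν → modelSubspace J y = modelSubspace J x
  mu_stable : ∀ y ∈ modelSubspace J x, gauge C (x - y) < ν →
    gauge C (minNormVector J x - minNormVector J y) ≤ μ * gauge C (x - y)
  tau_stable : ∀ y ∈ modelSubspace J x, gauge C (x - y) < ν →
    gauge (shiftedSubdifferential J x (f x)) ((parallelSubspace J x).starProjection (f x - f y))
      ≤ τ * gauge C (x - y)
  xi_stable : ∀ y ∈ modelSubspace J x, gauge C (x - y) < ν →
    ∀ u ∈ parallelSubspace J x, u ≠ 0 →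
      (gauge (shiftedSubdifferential J y (f y)) u - gauge (shiftedSubdifferential J x (f x)) u)
        / gauge (shiftedSubdifferential J x (f x)) u ≤ ξ * gauge C (x - y)

end Convex

section Inverse

variable {E F : Type*} [NormedAddCommGroup E] [InnerProductSpace ℝ E] [FiniteDimensional ℝ E]
  [NormedAddCommGroup F] [InnerProductSpace ℝ F] [FiniteDimensional ℝ F]

/-- `A` restricted to the orthogonal complement of its kernel is an isomorphism onto its range. -/
def kerOrthogonalEquivRange (A : E →L[ℝ] F) :
    ((A : E →ₗ[ℝ] F).ker)ᗮ ≃ₗ[ℝ] (A : E →ₗ[ℝ] F).range :=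
  ((A : E →ₗ[ℝ] F).ker.quotientEquivOfIsCompl _
    (A : E →ₗ[ℝ] F).ker.isCompl_orthogonal).symm.trans
    (A : E →ₗ[ℝ] F).quotKerEquivRange

/-- The Moore–Penrose pseudo-inverse `A⁺`: project onto the range of `A`, then invert `A` on the
orthogonal complement of its kernel. -/
def pinv (A : E →L[ℝ] F) : F →L[ℝ] E :=
  LinearMap.toContinuousLinearMap
    ((((A : E →ₗ[ℝ] F).ker)ᗮ).subtype ∘ₗ
      ((kerOrthogonalEquivRange A).symm : (A : E →ₗ[ℝ] F).range →ₗ[ℝ] ((A : E →ₗ[ℝ] F).ker)ᗮ) ∘ₗ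
      ((A : E →ₗ[ℝ] F).range.orthogonalProjectionOnto : F →ₗ[ℝ] (A : E →ₗ[ℝ] F).range))

set_option linter.unusedSectionVars false in
lemma map_kerOrthogonalEquivRange_symm (A : E →L[ℝ] F) (z : (A : E →ₗ[ℝ] F).range) :
    A ((kerOrthogonalEquivRange A).symm z : E) = z := by
  obtain ⟨x, rfl⟩ := (kerOrthogonalEquivRange A).surjective z
  simp only [LinearEquiv.symm_apply_apply]
  simp [kerOrthogonalEquivRange, LinearMap.quotKerEquivRange_apply_mk]

/-- `A A⁺` is the orthogonal projector onto the range of `A`. -/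
lemma comp_pinv (A : E →L[ℝ] F) :
    A ∘L pinv A = (A : E →ₗ[ℝ] F).range.starProjection := by
  ext y
  simp [pinv, map_kerOrthogonalEquivRange_symm]

/-- `A⁺ A` is the orthogonal projector onto the orthogonal complement of the kernel of `A`. -/
lemma pinv_comp (A : E →L[ℝ] F) :
    pinv A ∘L A = (((A : E →ₗ[ℝ] F).ker)ᗮ).starProjection := by
  ext x
  symm
  apply Submodule.eq_starProjection_of_mem_of_inner_eq_zero
  · simp [pinv]
  · intro w hw
    have h : A (x - pinv A (A x)) = 0 := by
      have := congrArg (fun B => B (A x)) (comp_pinv A)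
      simp only [ContinuousLinearMap.comp_apply] at this
      have h2 : (A : E →ₗ[ℝ] F).range.starProjection (A x) = A x :=
        Submodule.starProjection_eq_self_iff.mpr (LinearMap.mem_range_self (A : E →ₗ[ℝ] F) x)
      rw [map_sub, this, h2, sub_self]
    exact hw _ h

/-- The Irrepresentability Criterion
`IC(x) = γ_{∂J(x) - f}(Φ_S^* Φ_T^{+,*} e_x - P_S f)`, with `T = T_x`, `S = S_x`,
`Φ_T = Φ P_T`, `Φ_S = Φ P_S`. -/
def irrepresentabilityCriterion (Φ : E →L[ℝ] F) (J : E → ℝ) (x f : E) : ℝ :=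
  gauge (shiftedSubdifferential J x f)
    (ContinuousLinearMap.adjoint (Φ ∘L (parallelSubspace J x).starProjection)
        (ContinuousLinearMap.adjoint (pinv (Φ ∘L (modelSubspace J x).starProjection))
          (minNormVector J x))
      - (parallelSubspace J x).starProjection f)

/-- The objective function `x ↦ ‖y - Φ x‖² / 2 + lam J(x)` of the penalized problem. -/
def objective (Φ : E →L[ℝ] F) (J : E → ℝ) (y : F) (lam : ℝ) (x : E) : ℝ :=
  1 / 2 * ‖y - Φ x‖ ^ 2 + lam * J x

end Inverse

/-- `φ(u) = √(1 + u) - 1`. -/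
def phi (u : ℝ) : ℝ := Real.sqrt (1 + u) - 1

/-- `H(β) = (β + 1/2) / (ET β) · φ(2β / (β + 1)²)` for `β > 0`, extended by continuity at `0`. -/
def Hfun (ET β : ℝ) : ℝ :=
  if β = 0 then 1 / (2 * ET)
  else (β + 1 / 2) / (ET * β) * phi (2 * β / (β + 1) ^ 2)

/-- The constant `C(x₀) = (1 - IC) / (ξ ν) · H((DT μ + τ) / ξ)` for `ξ > 0`; for `ξ = 0` it is the
limit as `ξ → 0⁺`, that is `(1 - IC) / (ν ET (DT μ + τ))`, or `+∞` if also `DT μ + τ = 0`. -/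
def Cconst (DT ET ic ν μ τ ξ : ℝ) : EReal :=
  if ξ = 0 then
    if DT * μ + τ = 0 then ⊤
    else (((1 - ic) / (ν * (ET * (DT * μ + τ))) : ℝ) : EReal)
  else (((1 - ic) / (ξ * ν) * Hfun ET ((DT * μ + τ) / ξ) : ℝ) : EReal)

end

end PartlySmooth

/-! Minimize the objective over `T` alone. Injectivity of `Φ` on `T` makes its quadratic part
coercive there, so a minimizer `z` exists with `‖x₀ - z‖` of order `max ‖w‖ lam`
(`exists_isMinOn_submodule`). For `lam` small against `ν`, `z` lies in the stability region, hence
`T_z = T`. It remains to show that `z` is the unique minimizer on the whole space.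

Let `r = Φ x₀ + w - Φ z` and `u = lam⁻¹ Φ* r`. Optimality on `T` says that the `T`-component of `u`
is `e_z` (`inner_residual_eq_of_isMinOn`). Inverting through the pseudo-inverse
(`eq_adjoint_pinv_add`) splits `u - f z` into the vector whose gauge is `IC(x₀)`, the drifts of `e`
and `f`, and a noise term. The parameters `μ` and `τ` bound the drifts, so the gauge at `x₀` is at
most `IC + (D μ + τ) Γ(x₀ - z) + L ‖w‖ / lam` (`IsPSFL.gauge_certificate_le`). Passing to the gauge
at `z` costs a factor `1 + ξ Γ(x₀ - z)`. The bounds on `lam` keep the product below `1`, so `u` is a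
subgradient at `z` with room in every direction of `S`. Together with injectivity on `T` this forces
uniqueness (`isMinOn_objective_iff_eq`). -/

namespace PartlySmooth

open Filter Topology
open scoped Pointwise

/-! ### Gauges that are finite or coercive on a subspace. -/

section GaugeOnSubspace

variable {E : Type*} [NormedAddCommGroup E] [InnerProductSpace ℝ E]

/-- Every vector of `V` is a positive multiple of a point of `C`, so that the real-valued gauge of
`C` is the true gauge on `V`. -/
def FiniteOn (C : Set E) (V : Submodule ℝ E) : Prop :=
  ∀ y ∈ V, ∃ r : ℝ, 0 < r ∧ ∃ c ∈ C, y = r • c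

variable {C : Set E} {V : Submodule ℝ E}

/-- Finiteness makes the set defining the infimum nonempty; without it the real-valued gauge takes
the default value `0` and a small gauge carries no information. -/
lemma FiniteOn.exists_lt_of_gauge_lt (hf : FiniteOn C V) {x : E} (hx : x ∈ V) {a : ℝ}
    (h : gauge C x < a) : ∃ r, 0 < r ∧ r < a ∧ ∃ c ∈ C, x = r • c := by
  obtain ⟨r₀, hr₀, c₀, hc₀, hxc⟩ := hf x hx
  rw [gauge_def] at h
  have hne : {r ∈ Set.Ioi (0 : ℝ) | x ∈ r • C}.Nonempty := ⟨r₀, hr₀, c₀, hc₀, hxc.symm⟩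
  obtain ⟨r, ⟨hr, c, hc, hrc⟩, hra⟩ := exists_lt_of_csInf_lt hne h
  exact ⟨r, hr, hra, c, hc, hrc.symm⟩

lemma FiniteOn.gauge_add_le (hf : FiniteOn C V) (hC : Convex ℝ C) {x y : E} (hx : x ∈ V)
    (hy : y ∈ V) : gauge C (x + y) ≤ gauge C x + gauge C y := by
  refine le_of_forall_pos_lt_add fun ε hε => ?_
  obtain ⟨r, hr, hra, c, hc, rfl⟩ :=
    hf.exists_lt_of_gauge_lt hx (lt_add_of_pos_right (gauge C x) (half_pos hε))
  obtain ⟨s, hs, hsa, d, hd, rfl⟩ :=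
    hf.exists_lt_of_gauge_lt hy (lt_add_of_pos_right (gauge C y) (half_pos hε))
  have h : gauge C (r • c + s • d) ≤ r + s := by
    refine gauge_le_of_mem (by positivity) ?_
    refine ⟨(r / (r + s)) • c + (s / (r + s)) • d,
      hC hc hd (by positivity) (by positivity) (by field_simp), ?_⟩
    simp only [smul_add, smul_smul]
    congr 2 <;> field_simp
  linarith

lemma FiniteOn.gauge_sum_le (hf : FiniteOn C V) (hC : Convex ℝ C) {ι : Type*} (s : Finset ι)
    (x : ι → E) (hx : ∀ i ∈ s, x i ∈ V) : gauge C (∑ i ∈ s, x i) ≤ ∑ i ∈ s, gauge C (x i) := by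
  classical
  induction s using Finset.induction_on with
  | empty => simp
  | insert i s hi ih =>
    rw [Finset.sum_insert hi, Finset.sum_insert hi]
    have hs : ∀ j ∈ s, x j ∈ V := fun j hj => hx j (Finset.mem_insert_of_mem hj)
    exact (hf.gauge_add_le hC (hx i (Finset.mem_insert_self i s)) (V.sum_mem hs)).trans
      (by gcongr; exact ih hs)

lemma FiniteOn.mem_of_gauge_lt_one (hf : FiniteOn C V) (hC : Convex ℝ C) (h0 : (0 : E) ∈ C)
    {x : E} (hx : x ∈ V) (h : gauge C x < 1) : x ∈ C := by
  obtain ⟨r, hr, hr1, c, hc, rfl⟩ := hf.exists_lt_of_gauge_lt hx h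
  exact hC.smul_mem_of_zero_mem h0 hc ⟨hr.le, hr1.le⟩

/-- `C` need not be symmetric, so the gauges of both `x` and `-x` enter. -/
lemma gauge_smul_le_abs_mul (x : E) (t : ℝ) :
    gauge C (t • x) ≤ |t| * (gauge C x + gauge C (-x)) := by
  have h1 := gauge_nonneg (s := C) x
  have h2 := gauge_nonneg (s := C) (-x)
  rcases le_total 0 t with ht | ht
  · rw [gauge_smul_of_nonneg ht, smul_eq_mul, abs_of_nonneg ht]
    gcongr
    linarith
  · rw [show t • x = (-t) • (-x) by simp, gauge_smul_of_nonneg (neg_nonneg.2 ht), smul_eq_mul,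
      abs_of_nonpos ht]
    have : 0 ≤ -t := neg_nonneg.2 ht
    gcongr
    linarith

/-- A finite gauge on a finite-dimensional subspace is bounded by a multiple of the norm. -/
lemma FiniteOn.exists_gauge_le_norm [FiniteDimensional ℝ E] (hf : FiniteOn C V)
    (hC : Convex ℝ C) : ∃ a : ℝ, 0 < a ∧ ∀ x ∈ V, gauge C x ≤ a * ‖x‖ := by
  set b := stdOrthonormalBasis ℝ V
  refine ⟨1 + ∑ i, (gauge C (b i : E) + gauge C (-(b i : E))), ?_, fun x hx => ?_⟩
  · have : 0 ≤ ∑ i, (gauge C (b i : E) + gauge C (-(b i : E))) :=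
      Finset.sum_nonneg fun i _ => add_nonneg (gauge_nonneg _) (gauge_nonneg _)
    linarith
  · have hsum : x = ∑ i, (b.repr ⟨x, hx⟩ i) • (b i : E) := by
      have h := congrArg (Subtype.val) (b.sum_repr ⟨x, hx⟩)
      simpa using h.symm
    have hcoord : ∀ i, |b.repr ⟨x, hx⟩ i| ≤ ‖x‖ := fun i => by
      rw [b.repr_apply_apply]
      refine (abs_real_inner_le_norm _ _).trans ?_
      simp
    calc gauge C x = gauge C (∑ i, (b.repr ⟨x, hx⟩ i) • (b i : E)) := by rw [← hsum]
      _ ≤ ∑ i, gauge C ((b.repr ⟨x, hx⟩ i) • (b i : E)) :=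
        hf.gauge_sum_le hC _ _ fun i _ => V.smul_mem _ (b i).2
      _ ≤ ∑ i, ‖x‖ * (gauge C (b i : E) + gauge C (-(b i : E))) := by
        refine Finset.sum_le_sum fun i _ => (gauge_smul_le_abs_mul _ _).trans ?_
        gcongr
        · exact add_nonneg (gauge_nonneg _) (gauge_nonneg _)
        · exact hcoord i
      _ ≤ _ := by
        rw [← Finset.mul_sum]
        nlinarith [norm_nonneg x]

/-- A coercive gauge on a subspace dominates a multiple of the norm. -/
lemma exists_norm_le_gauge
    (h : Tendsto (fun y : V => gauge C (y : E)) (Bornology.cobounded V) atTop) :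
    ∃ b : ℝ, 0 < b ∧ ∀ x ∈ V, ‖x‖ ≤ b * gauge C x := by
  have h1 := h.eventually_ge_atTop 1
  rw [← comap_norm_atTop, eventually_comap] at h1
  -- The gauge is at least `1` on every sphere of radius at least `R`; homogeneity carries the bound
  -- from the sphere of radius `ρ` to all of `V`.
  obtain ⟨R, hR⟩ := eventually_atTop.1 h1
  set ρ := max R 1
  have hρ : 0 < ρ := lt_max_of_lt_right one_pos
  refine ⟨ρ, hρ, fun x hx => ?_⟩
  rcases eq_or_ne x 0 with rfl | hx0
  · simp
  have hn : 0 < ‖x‖ := norm_pos_iff.2 hx0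
  have h2 := hR ρ (le_max_left _ _) ((ρ / ‖x‖) • ⟨x, hx⟩)
    (by rw [norm_smul, Real.norm_of_nonneg (by positivity), Submodule.coe_norm]; field_simp)
  rw [Submodule.coe_smul, gauge_smul_of_nonneg (by positivity : (0 : ℝ) ≤ ρ / ‖x‖),
    smul_eq_mul, div_mul_eq_mul_div, le_div_iff₀ hn] at h2
  linarith

/-- If `C` lies in the ball of radius `R`, its gauge is at least `‖x‖ / R` on `V`. -/
lemma FiniteOn.gauge_pos (hf : FiniteOn C V) (hC : Bornology.IsBounded C) {x : E} (hx : x ∈ V)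
    (hx0 : x ≠ 0) : 0 < gauge C x := by
  obtain ⟨R, hR0, hR⟩ := hC.exists_pos_norm_le
  by_contra h
  have hn : 0 < ‖x‖ := norm_pos_iff.2 hx0
  obtain ⟨r, hr, hr1, c, hc, hxc⟩ :=
    hf.exists_lt_of_gauge_lt hx ((not_lt.1 h).trans_lt (div_pos hn hR0))
  have h1 : ‖x‖ ≤ r * R := by
    rw [hxc, norm_smul, Real.norm_of_nonneg hr.le]
    gcongr
    exact hR c hc
  rw [lt_div_iff₀ hR0] at hr1
  linarith

/-- The translate of a set by a point of its relative interior is absorbing in the direction of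
its affine hull. -/
lemma finiteOn_of_mem_intrinsicInterior {s : Set E} {p : E} (hp : p ∈ intrinsicInterior ℝ s) :
    FiniteOn {v | p + v ∈ s} (affineSpan ℝ s).direction := by
  intro u hu
  obtain ⟨y, hy, rfl⟩ := mem_intrinsicInterior.1 hp
  let g : ℝ → affineSpan ℝ s :=
    fun t => ⟨t • u +ᵥ (y : E), AffineSubspace.vadd_mem_of_mem_direction
      (Submodule.smul_mem _ t hu) y.2⟩
  have hg : Continuous g := by
    refine Continuous.subtype_mk ?_ _
    simp only [vadd_eq_add]
    fun_prop
  have hg0 : g 0 = y := by ext; simp [g]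
  have hev : ∀ᶠ t in 𝓝 (0 : ℝ), g t ∈ ((↑) ⁻¹' s : Set (affineSpan ℝ s)) :=
    hg.continuousAt.eventually_mem (by rw [hg0]; exact mem_interior_iff_mem_nhds.1 hy)
  obtain ⟨t, ht, ht0⟩ :=
    ((hev.filter_mono nhdsWithin_le_nhds).and
      (self_mem_nhdsWithin : Set.Ioi (0 : ℝ) ∈ 𝓝[>] 0)).exists
  have ht0 : 0 < t := ht0
  refine ⟨t⁻¹, inv_pos.2 ht0, t • u, ?_, by rw [smul_smul, inv_mul_cancel₀ ht0.ne', one_smul]⟩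
  have : t • u + (y : E) ∈ s := ht
  simpa [add_comm] using this

end GaugeOnSubspace

end PartlySmooth

namespace PartlySmooth

open Filter Topology

/-! ### Subgradients, their extension from a subspace, and the vector `e_x`. -/

section Subdifferential

variable {E : Type*} [NormedAddCommGroup E] [InnerProductSpace ℝ E] {J : E → ℝ} {x : E}

lemma mem_subdifferential_iff_add {u : E} :
    u ∈ subdifferential J x ↔ ∀ h, J x + inner ℝ u h ≤ J (x + h) :=
  ⟨fun hu h => by simpa using hu (x + h), fun hu y => by simpa using hu (y - x)⟩

lemma convex_subdifferential (J : E → ℝ) (x : E) : Convex ℝ (subdifferential J x) := by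
  intro u hu v hv a b ha hb hab y
  have h1 := mul_le_mul_of_nonneg_left (hu y) ha
  have h2 := mul_le_mul_of_nonneg_left (hv y) hb
  rw [inner_add_left, real_inner_smul_left, real_inner_smul_left]
  have h3 : J x = a * J x + b * J x := by rw [← add_mul, hab, one_mul]
  have h4 : J y = a * J y + b * J y := by rw [← add_mul, hab, one_mul]
  linarith

lemma sub_mem_parallelSubspace {u v : E} (hu : u ∈ subdifferential J x)
    (hv : v ∈ subdifferential J x) : u - v ∈ parallelSubspace J x :=
  AffineSubspace.vsub_mem_direction (subset_affineSpan ℝ _ hu) (subset_affineSpan ℝ _ hv)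

lemma convex_shiftedSubdifferential (J : E → ℝ) (x f : E) :
    Convex ℝ (shiftedSubdifferential J x f) :=
  (convex_subdifferential J x).translate_preimage_right f

lemma zero_mem_shiftedSubdifferential {f : E} (hf : f ∈ subdifferential J x) :
    (0 : E) ∈ shiftedSubdifferential J x f := by
  simpa [shiftedSubdifferential] using hf

lemma finiteOn_shiftedSubdifferential {f : E}
    (hf : f ∈ intrinsicInterior ℝ (subdifferential J x)) :
    FiniteOn (shiftedSubdifferential J x f) (parallelSubspace J x) :=
  finiteOn_of_mem_intrinsicInterior hf

/-- A subdifferential inequality on a subspace extends to a subgradient (Hahn–Banach for the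
directional derivative of `J` at `x`). -/
lemma exists_subgradient_of_le_on_submodule [FiniteDimensional ℝ E] (hJ : ConvexOn ℝ Set.univ J)
    {p : E} (hp : p ∈ subdifferential J x) (V : Submodule ℝ E) (g : E)
    (hg : ∀ h ∈ V, J x + inner ℝ g h ≤ J (x + h)) :
    ∃ u ∈ subdifferential J x, ∀ h ∈ V, inner ℝ u h = inner ℝ g h := by
  rw [mem_subdifferential_iff_add] at hp
  let q : E → Set.Ioi (0 : ℝ) → ℝ := fun h t => (J (x + (t : ℝ) • h) - J x) / t
  have hlow : ∀ (a h : E), (∀ t : ℝ, 0 < t → J x + inner ℝ a (t • h) ≤ J (x + t • h)) →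
      ∀ t : Set.Ioi (0 : ℝ), inner ℝ a h ≤ q h t := by
    rintro a h ha ⟨t, ht⟩
    have ht : 0 < t := ht
    have := ha t ht
    rw [real_inner_smul_right] at this
    rw [le_div_iff₀ ht]
    simp only
    linarith
  have hbdd : ∀ h, BddBelow (Set.range (q h)) := fun h =>
    ⟨inner ℝ p h, by rintro _ ⟨t, rfl⟩; exact hlow p h (fun t _ => hp _) t⟩
  -- The directional derivative of `J` at `x`, written as an infimum of difference quotients, which
  -- the subgradient `p` bounds below.
  let D : E → ℝ := fun h => ⨅ t, q h t
  have hne : Nonempty (Set.Ioi (0 : ℝ)) := ⟨⟨1, Set.mem_Ioi.2 one_pos⟩⟩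
  have hhom_le : ∀ c : ℝ, 0 < c → ∀ h, D (c • h) ≤ c * D h := by
    intro c hc h
    rw [Real.mul_iInf_of_nonneg hc.le]
    refine le_ciInf fun t => ?_
    have ht : (0 : ℝ) < t := t.2
    refine (ciInf_le (hbdd _) ⟨t / c, div_pos ht hc⟩).trans (le_of_eq ?_)
    simp only [q, smul_smul, div_mul_cancel₀ _ hc.ne']
    field_simp
  have hhom : ∀ c : ℝ, 0 < c → ∀ h, D (c • h) = c * D h := by
    intro c hc h
    refine le_antisymm (hhom_le c hc h) ?_
    have := hhom_le c⁻¹ (inv_pos.2 hc) (c • h)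
    rw [smul_smul, inv_mul_cancel₀ hc.ne', one_smul] at this
    rwa [inv_mul_eq_div, le_div_iff₀ hc, mul_comm] at this
  have hadd : ∀ h k, D (h + k) ≤ D h + D k := by
    intro h k
    refine le_ciInf_add_ciInf fun ⟨t, ht⟩ ⟨s, hs⟩ => ?_
    have ht : 0 < t := ht
    have hs : 0 < s := hs
    -- With this step length, `x + (ts/(t+s)) • (h + k)` is the convex combination of `x + t • h`
    -- and `x + s • k` with weights `s/(t+s)` and `t/(t+s)`.
    refine (ciInf_le (hbdd _) ⟨t * s / (t + s), by simp only [Set.mem_Ioi]; positivity⟩).trans ?_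
    have hc := hJ.2 (Set.mem_univ (x + t • h)) (Set.mem_univ (x + s • k))
      (show 0 ≤ s / (t + s) by positivity) (show 0 ≤ t / (t + s) by positivity)
      (by field_simp; ring)
    have hx : (s / (t + s)) • (x + t • h) + (t / (t + s)) • (x + s • k)
        = x + (t * s / (t + s)) • (h + k) := by
      have h1 : (s / (t + s) + t / (t + s)) • x = x := by
        rw [show s / (t + s) + t / (t + s) = 1 by field_simp; ring, one_smul]
      conv_rhs => rw [← h1]
      simp only [smul_add, smul_smul, add_smul]
      rw [show s / (t + s) * t = t * s / (t + s) by ring,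
        show t / (t + s) * s = t * s / (t + s) by ring]
      abel
    rw [hx, smul_eq_mul, smul_eq_mul] at hc
    simp only [q]
    rw [div_le_iff₀ (by positivity)]
    have : ((J (x + t • h) - J x) / t + (J (x + s • k) - J x) / s) * (t * s / (t + s))
        = s / (t + s) * J (x + t • h) + t / (t + s) * J (x + s • k) - J x := by
      field_simp
      ring
    rw [this]
    linarith
  obtain ⟨l, hl1, hl2⟩ := exists_extension_of_le_sublinear
    ⟨V, (innerₛₗ ℝ g).comp V.subtype⟩ D hhom hadd (by
      rintro ⟨h, hh⟩
      refine le_ciInf fun t => ?_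
      exact hlow g h (fun t _ => hg _ (V.smul_mem t hh)) t)
  refine ⟨(InnerProductSpace.toDual ℝ E).symm l.toContinuousLinearMap, ?_, fun h hh => ?_⟩
  · rw [mem_subdifferential_iff_add]
    intro h
    have h1 := (hl2 h).trans (ciInf_le (hbdd h) ⟨1, Set.mem_Ioi.2 one_pos⟩)
    simp only [q, one_smul, div_one] at h1
    simp only [InnerProductSpace.toDual_symm_apply, LinearMap.coe_toContinuousLinearMap']
    linarith
  · simpa using hl1 ⟨h, hh⟩

variable [FiniteDimensional ℝ E]

lemma orthogonal_modelSubspace (J : E → ℝ) (x : E) :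
    (modelSubspace J x)ᗮ = parallelSubspace J x :=
  Submodule.orthogonal_orthogonal _

lemma minNormVector_mem_modelSubspace {f : E} (hf : f ∈ subdifferential J x) :
    minNormVector J x ∈ modelSubspace J x := by
  have h : Nonempty (affineSpan ℝ (subdifferential J x)) := ⟨⟨f, subset_affineSpan ℝ _ hf⟩⟩
  rw [minNormVector, dif_pos h]
  simpa [modelSubspace, parallelSubspace] using
    EuclideanGeometry.orthogonalProjection_vsub_mem_direction_orthogonal
    (affineSpan ℝ (subdifferential J x)) (0 : E)

lemma sub_minNormVector_mem_parallelSubspace {f : E} (hf : f ∈ subdifferential J x) :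
    f - minNormVector J x ∈ parallelSubspace J x := by
  have h : Nonempty (affineSpan ℝ (subdifferential J x)) := ⟨⟨f, subset_affineSpan ℝ _ hf⟩⟩
  rw [minNormVector, dif_pos h]
  exact AffineSubspace.vsub_mem_direction (subset_affineSpan ℝ _ hf)
    (EuclideanGeometry.orthogonalProjection_mem _)

/-- Subgradients differ from `e_x` only along `S_x`, so they all share its component on `T_x`. -/
lemma inner_minNormVector {f h : E} (hf : f ∈ subdifferential J x) (hh : h ∈ modelSubspace J x) :
    inner ℝ (minNormVector J x) h = inner ℝ f h := by
  have := Submodule.inner_right_of_mem_orthogonal (sub_minNormVector_mem_parallelSubspace hf) hh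
  rw [inner_sub_left] at this
  linarith

lemma continuous_of_convexOn_univ (hJ : ConvexOn ℝ Set.univ J) : Continuous J :=
  hJ.locallyLipschitz.continuous

lemma isBounded_subdifferential (hJ : ConvexOn ℝ Set.univ J) (x : E) :
    Bornology.IsBounded (subdifferential J x) := by
  obtain ⟨B, hB⟩ := (isCompact_closedBall x 1).bddAbove_image
    (continuous_of_convexOn_univ hJ).continuousOn
  refine isBounded_iff_forall_norm_le.2 ⟨B - J x, fun u hu => ?_⟩
  rcases eq_or_ne u 0 with rfl | hu0
  · have := hB ⟨x, Metric.mem_closedBall_self zero_le_one, rfl⟩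
    simpa using this
  have hn : 0 < ‖u‖ := norm_pos_iff.2 hu0
  have h1 := mem_subdifferential_iff_add.1 hu (‖u‖⁻¹ • u)
  have h2 : J (x + ‖u‖⁻¹ • u) ≤ B := hB ⟨_, by
    rw [mem_closedBall_iff_norm, add_sub_cancel_left, norm_smul, norm_inv, norm_norm,
      inv_mul_cancel₀ hn.ne'], rfl⟩
  rw [real_inner_smul_right, real_inner_self_eq_norm_sq, pow_two, inv_mul_cancel_left₀ hn.ne'] at h1
  linarith

lemma isBounded_shiftedSubdifferential (hJ : ConvexOn ℝ Set.univ J) (x f : E) :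
    Bornology.IsBounded (shiftedSubdifferential J x f) := by
  obtain ⟨R, hR⟩ := isBounded_iff_forall_norm_le.1 (isBounded_subdifferential hJ x)
  refine isBounded_iff_forall_norm_le.2 ⟨R + ‖f‖, fun v hv => ?_⟩
  calc ‖v‖ = ‖(f + v) - f‖ := by rw [add_sub_cancel_left]
    _ ≤ ‖f + v‖ + ‖f‖ := norm_sub_le _ _
    _ ≤ R + ‖f‖ := by gcongr; exact hR _ hv

end Subdifferential

end PartlySmooth

namespace PartlySmooth

open Filter Topology
open ContinuousLinearMap (adjoint)

/-! ### Minimization over a subspace, optimality conditions and uniqueness. -/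

section Optimization

variable {E F : Type*} [NormedAddCommGroup E] [InnerProductSpace ℝ E]
  [NormedAddCommGroup F] [InnerProductSpace ℝ F]
  {Φ : E →L[ℝ] F} {J : E → ℝ} {y w : F} {lam : ℝ} {x : E} {T : Submodule ℝ E}

lemma objective_add (Φ : E →L[ℝ] F) (J : E → ℝ) (y : F) (lam : ℝ) (x h : E) :
    objective Φ J y lam (x + h) = objective Φ J y lam x + 1 / 2 * ‖Φ h‖ ^ 2
      - inner ℝ (y - Φ x) (Φ h) + lam * (J (x + h) - J x) := by
  rw [objective, objective, map_add, ← sub_sub, norm_sub_sq_real]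
  ring

/-- First-order condition for the minimization of the objective over a subspace. -/
lemma inner_residual_le_of_isMinOn (hJ : ConvexOn ℝ Set.univ J) (hx : x ∈ T)
    (hmin : IsMinOn (objective Φ J y lam) T x) (hlam : 0 < lam) {h : E} (hh : h ∈ T) :
    inner ℝ (y - Φ x) (Φ h) ≤ lam * (J (x + h) - J x) := by
  by_contra! hlt
  set δ := inner ℝ (y - Φ x) (Φ h) - lam * (J (x + h) - J x)
  have hδ : 0 < δ := sub_pos.2 hlt
  -- A step this short keeps the quadratic term `s² ‖Φ h‖² / 2` below the first-order gain `s δ`,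
  -- contradicting minimality.
  set s := min 1 (δ / (‖Φ h‖ ^ 2 + 1))
  have hs : 0 < s := lt_min one_pos (by positivity)
  have hs1 : s ≤ 1 := min_le_left _ _
  have hs2 : s * (‖Φ h‖ ^ 2 + 1) ≤ δ := (le_div_iff₀ (by positivity)).1 (min_le_right _ _)
  have h1 : objective Φ J y lam x ≤ objective Φ J y lam (x + s • h) :=
    hmin (T.add_mem hx (T.smul_mem s hh))
  rw [objective_add, map_smul, norm_smul, Real.norm_of_nonneg hs.le, real_inner_smul_right] at h1
  have h2 := hJ.2 (Set.mem_univ x) (Set.mem_univ (x + h)) (sub_nonneg.2 hs1) hs.le (by ring)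
  rw [show (1 - s) • x + s • (x + h) = x + s • h by module, smul_eq_mul, smul_eq_mul] at h2
  have h3 : lam * (J (x + s • h) - J x) ≤ lam * (s * (J (x + h) - J x)) := by
    gcongr
    linarith
  have h4 : s * δ ≤ s * (1 / 2 * s * ‖Φ h‖ ^ 2) := by
    simp only [δ]
    nlinarith
  have h5 := le_of_mul_le_mul_left h4 hs
  nlinarith [sq_nonneg ‖Φ h‖]

variable [FiniteDimensional ℝ E]

lemma continuous_objective (hJ : ConvexOn ℝ Set.univ J) : Continuous (objective Φ J y lam) := by
  have := continuous_of_convexOn_univ hJ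
  unfold objective
  fun_prop

/-- A linear map that is injective on a subspace is bounded below there. -/
lemma exists_norm_le_of_ker_inf_eq_bot (hinj : (Φ : E →ₗ[ℝ] F).ker ⊓ T = ⊥) :
    ∃ c : ℝ, 0 < c ∧ ∀ h ∈ T, c * ‖h‖ ≤ ‖Φ h‖ := by
  obtain ⟨K, hK, hanti⟩ := LinearMap.exists_antilipschitzWith ((Φ : E →ₗ[ℝ] F).comp T.subtype) (by
    rw [LinearMap.ker_eq_bot']
    rintro ⟨m, hm⟩ h0
    have : m ∈ (Φ : E →ₗ[ℝ] F).ker ⊓ T := ⟨h0, hm⟩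
    rw [hinj, Submodule.mem_bot] at this
    simpa using this)
  have hK' : (0 : ℝ) < K := hK
  refine ⟨(K : ℝ)⁻¹, inv_pos.2 hK', fun h hh => ?_⟩
  have := hanti.le_mul_dist ⟨h, hh⟩ 0
  rw [dist_zero_right, map_zero, dist_zero_right] at this
  rw [inv_mul_le_iff₀ hK']
  simpa using this

/-- The objective restricted to `T` has a minimizer, close to a point `x` of `T` where `J` has a
subgradient on `T`. -/
lemma exists_isMinOn_submodule (hJ : ConvexOn ℝ Set.univ J) (hx : x ∈ T) {e : E}
    (he : ∀ h ∈ T, J x + inner ℝ e h ≤ J (x + h)) {c : ℝ} (hc : 0 < c)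
    (hΦ : ∀ h ∈ T, c * ‖h‖ ≤ ‖Φ h‖) (w : F) (hlam : 0 < lam) :
    ∃ z ∈ T, IsMinOn (objective Φ J (Φ x + w) lam) T z ∧
      ‖x - z‖ ≤ 2 * (‖Φ‖ * ‖w‖ + lam * ‖e‖) / c ^ 2 := by
  set R := 2 * (‖Φ‖ * ‖w‖ + lam * ‖e‖) / c ^ 2
  have hR : 0 ≤ R := by positivity
  -- The sublevel set of `x` within `T` lies in a ball of radius `R`, so minimizing over a compact
  -- set suffices and the distance bound comes with it.
  have key : ∀ z ∈ T, objective Φ J (Φ x + w) lam z ≤ objective Φ J (Φ x + w) lam x →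
      ‖x - z‖ ≤ R := by
    intro z hz hle
    have hh : z - x ∈ T := T.sub_mem hz hx
    have h1 := objective_add Φ J (Φ x + w) lam x (z - x)
    have h2 := he _ hh
    rw [add_sub_cancel] at h1 h2
    rw [add_sub_cancel_left] at h1
    have h3 : inner ℝ w (Φ (z - x)) ≤ ‖w‖ * (‖Φ‖ * ‖z - x‖) :=
      (real_inner_le_norm _ _).trans (by gcongr; exact Φ.le_opNorm _)
    have h4 : -(‖e‖ * ‖z - x‖) ≤ inner ℝ e (z - x) :=
      (abs_le.1 (abs_real_inner_le_norm _ _)).1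
    have h5 : (c * ‖z - x‖) ^ 2 ≤ ‖Φ (z - x)‖ ^ 2 := by gcongr; exact hΦ _ hh
    have h6 : lam * (-(‖e‖ * ‖z - x‖)) ≤ lam * (J z - J x) := by
      gcongr
      linarith
    rw [norm_sub_rev]
    rcases (norm_nonneg (z - x)).eq_or_lt with h0 | h0
    · rw [← h0]; exact hR
    rw [le_div_iff₀ (by positivity)]
    refine le_of_mul_le_mul_right ?_ h0
    nlinarith
  obtain ⟨z, ⟨hzT, -⟩, hzmin⟩ :=
    ((isCompact_closedBall x R).inter_left T.closed_of_finiteDimensional).exists_isMinOn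
      ⟨x, hx, Metric.mem_closedBall_self hR⟩
      (continuous_objective (Φ := Φ) (y := Φ x + w) (lam := lam) hJ).continuousOn
  have hzx := hzmin (show x ∈ (T : Set E) ∩ Metric.closedBall x R from
    ⟨hx, Metric.mem_closedBall_self hR⟩)
  refine ⟨z, hzT, fun v hv => ?_, key z hzT hzx⟩
  rcases le_total (objective Φ J (Φ x + w) lam v) (objective Φ J (Φ x + w) lam x) with h | h
  · exact hzmin ⟨hv, by rw [mem_closedBall_iff_norm']; exact key v hv h⟩
  · exact le_trans hzx h

variable [FiniteDimensional ℝ F]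

/-- On a subspace of the model subspace, the gradient of the data term at a minimizer over that
subspace is given by the minimal norm vector. -/
lemma inner_residual_eq_of_isMinOn (hJ : ConvexOn ℝ Set.univ J) (hx : x ∈ T)
    (hT : T ≤ modelSubspace J x) {p : E} (hp : p ∈ subdifferential J x)
    (hmin : IsMinOn (objective Φ J y lam) T x) (hlam : 0 < lam) {h : E} (hh : h ∈ T) :
    inner ℝ (y - Φ x) (Φ h) = lam * inner ℝ (minNormVector J x) h := by
  have hin : ∀ k, inner ℝ (lam⁻¹ • adjoint Φ (y - Φ x)) k = lam⁻¹ * inner ℝ (y - Φ x) (Φ k) :=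
    fun k => by rw [real_inner_smul_left, ContinuousLinearMap.adjoint_inner_left]
  -- Optimality on `T` gives the subgradient inequality only along `T`; it is extended to a true
  -- subgradient, whose component on `T` is then known.
  obtain ⟨u, hu, huT⟩ := exists_subgradient_of_le_on_submodule hJ hp T
    (lam⁻¹ • adjoint Φ (y - Φ x)) (fun k hk => by
      have h1 := inner_residual_le_of_isMinOn hJ hx hmin hlam hk
      rw [hin]
      rw [← inv_mul_le_iff₀ hlam] at h1
      linarith)
  rw [inner_minNormVector hu (hT hh), huT h hh, hin, mul_inv_cancel_left₀ hlam.ne']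

/-- A non-degenerate dual certificate makes `x` the only minimizer. -/
lemma isMinOn_objective_iff_eq (hlam : 0 < lam) {u : E}
    (hu : u ∈ subdifferential J x) (hΦu : adjoint Φ (y - Φ x) = lam • u)
    (hri : ∀ s ∈ parallelSubspace J x, ∃ ε : ℝ, 0 < ε ∧ u + ε • s ∈ subdifferential J x)
    (hinj : (Φ : E →ₗ[ℝ] F).ker ⊓ modelSubspace J x = ⊥) (z : E) :
    IsMinOn (objective Φ J y lam) Set.univ z ↔ z = x := by
  -- The excess over the value at `x` is a sum of two nonnegative terms, so both vanish at any other
  -- minimizer.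
  have hexp : ∀ z, objective Φ J y lam z = objective Φ J y lam x + 1 / 2 * ‖Φ (z - x)‖ ^ 2
      + lam * (J z - J x - inner ℝ u (z - x)) := by
    intro z
    have h := objective_add Φ J y lam x (z - x)
    rw [add_sub_cancel, ← ContinuousLinearMap.adjoint_inner_left, hΦu, real_inner_smul_left] at h
    rw [h]
    ring
  have hnn : ∀ z, 0 ≤ lam * (J z - J x - inner ℝ u (z - x)) := fun z =>
    mul_nonneg hlam.le (by linarith [hu z])
  constructor
  · intro hz
    have hle : objective Φ J y lam z ≤ objective Φ J y lam x := hz (Set.mem_univ x)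
    rw [hexp z] at hle
    have hΦ0 : Φ (z - x) = 0 := by
      have : ‖Φ (z - x)‖ ^ 2 ≤ 0 := by linarith [hnn z]
      simpa using le_antisymm this (sq_nonneg _)
    have hJz : J z - J x ≤ inner ℝ u (z - x) := by
      by_contra! hlt
      have := mul_pos hlam (sub_pos.2 hlt)
      nlinarith [sq_nonneg ‖Φ (z - x)‖]
    -- Since `u + ε • s` is still a subgradient, equality in the inequality for `u` leaves no room
    -- for a positive product; using `±s` gives orthogonality to `S_x`.
    have hle0 : ∀ s ∈ parallelSubspace J x, inner ℝ s (z - x) ≤ 0 := by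
      intro s hs
      obtain ⟨ε, hε, hmem⟩ := hri s hs
      have := hmem z
      rw [inner_add_left, real_inner_smul_left] at this
      by_contra! hlt
      have := mul_pos hε hlt
      linarith
    have hmodel : z - x ∈ modelSubspace J x := by
      refine (Submodule.mem_orthogonal _ _).2 fun s hs => le_antisymm (hle0 s hs) ?_
      have := hle0 (-s) (Submodule.neg_mem _ hs)
      rw [inner_neg_left] at this
      linarith
    have hbot : z - x ∈ (Φ : E →ₗ[ℝ] F).ker ⊓ modelSubspace J x := ⟨hΦ0, hmodel⟩
    rw [hinj, Submodule.mem_bot] at hbot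
    exact sub_eq_zero.1 hbot
  · rintro rfl v -
    have := hexp v
    have := hnn v
    have := sq_nonneg ‖Φ (v - z)‖
    simp only [Set.mem_ofPred_eq]
    linarith

/-- A vector is recovered from its image under `A*` and its component orthogonal to the range
of `A`. -/
lemma eq_adjoint_pinv_add (A : E →L[ℝ] F) {r : F} {e : E}
    (hr : adjoint A r = lam • e) (hrw : r - w ∈ (A : E →ₗ[ℝ] F).range) :
    r = lam • adjoint (pinv A) e + (w - (A : E →ₗ[ℝ] F).range.starProjection w) := by
  -- Taking adjoints of `A A⁺ = P` gives `A⁺* A* = P`, as `P` is self-adjoint.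
  have h1 : lam • adjoint (pinv A) e = (A : E →ₗ[ℝ] F).range.starProjection r := by
    rw [← map_smul, ← hr, ← ContinuousLinearMap.comp_apply, ← ContinuousLinearMap.adjoint_comp,
      comp_pinv]
    exact congrArg (fun B : F →L[ℝ] F => B r) (isSelfAdjoint_starProjection _).adjoint_eq
  have h2 := Submodule.starProjection_eq_self_iff.2 hrw
  rw [map_sub] at h2
  rw [h1, add_sub_left_comm, h2]
  abel

end Optimization

/-! ### Turning the bound with `H` into a linear condition on `lam`. -/

section Scalar

lemma phi_le_half {u : ℝ} (hu : 0 ≤ u) : phi u ≤ u / 2 := by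
  rw [phi, sub_le_iff_le_add, Real.sqrt_le_left (by positivity)]
  nlinarith [sq_nonneg u]

/-- The concavity bound `φ(u) ≤ u / 2` is all that the argument needs of `H`. -/
lemma Hfun_le {ET β : ℝ} (hE : 0 < ET) (hβ : 0 ≤ β) : Hfun ET β ≤ 1 / (ET * (β + 1)) := by
  rcases hβ.eq_or_lt with rfl | hβ
  · rw [Hfun, if_pos rfl]
    rw [zero_add, mul_one]
    exact one_div_le_one_div_of_le hE (by linarith)
  · rw [Hfun, if_neg hβ.ne']
    calc (β + 1 / 2) / (ET * β) * phi (2 * β / (β + 1) ^ 2)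
        ≤ (β + 1 / 2) / (ET * β) * (2 * β / (β + 1) ^ 2 / 2) := by
          gcongr
          exact phi_le_half (by positivity)
      _ = (β + 1 / 2) / (ET * (β + 1) ^ 2) := by field_simp
      _ ≤ (β + 1) / (ET * (β + 1) ^ 2) := by gcongr; norm_num
      _ = 1 / (ET * (β + 1)) := by field_simp

/-- What the upper bound on the regularization parameter amounts to. -/
lemma mul_le_of_le_mul_min_Cconst {BT DT ET ic ν μ τ ξ lam : ℝ} (hD : 0 < DT) (hE : 0 < ET)
    (hic : ic < 1) (hν : 0 ≤ ν) (hμ : 0 ≤ μ) (hτ : 0 ≤ τ) (hξ : 0 ≤ ξ) (hlam : 0 < lam)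
    (h : (lam : EReal) ≤ (ν : EReal) * min (BT : EReal) (Cconst DT ET ic ν μ τ ξ)) :
    0 < ν ∧ lam ≤ ν * BT ∧ ET * (ξ + (DT * μ + τ)) * lam ≤ 1 - ic := by
  have hν0 : 0 < ν := by
    refine hν.lt_of_ne' fun h0 => ?_
    -- In `EReal`, `0 * ⊤ = 0`, so `ν = 0` is excluded even when `Cconst` is infinite.
    rw [h0, EReal.coe_zero, zero_mul] at h
    exact absurd hlam (not_lt.2 (EReal.coe_le_coe_iff.1 h))
  have hνE : (0 : EReal) ≤ ν := EReal.coe_nonneg.2 hν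
  refine ⟨hν0, ?_, ?_⟩
  · have := h.trans (mul_le_mul_of_nonneg_left (min_le_left _ _) hνE)
    rwa [← EReal.coe_mul, EReal.coe_le_coe_iff] at this
  have h2 := h.trans (mul_le_mul_of_nonneg_left (min_le_right _ _) hνE)
  have hι : 0 < 1 - ic := sub_pos.2 hic
  have hq : 0 ≤ DT * μ + τ := by positivity
  set q := DT * μ + τ
  rcases hξ.eq_or_lt with rfl | hξ
  · rcases hq.eq_or_lt with hq0 | hq0
    · rw [← hq0]
      simpa using hic.le
    · rw [Cconst, if_pos rfl, if_neg hq0.ne', ← EReal.coe_mul, EReal.coe_le_coe_iff] at h2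
      rw [show ν * ((1 - ic) / (ν * (ET * q))) = (1 - ic) / (ET * q) by field_simp,
        le_div_iff₀ (by positivity)] at h2
      linarith
  · rw [Cconst, if_neg hξ.ne', ← EReal.coe_mul, EReal.coe_le_coe_iff] at h2
    have h3 := Hfun_le (β := q / ξ) hE (by positivity)
    have h4 : lam ≤ (1 - ic) / (ET * (ξ + q)) := by
      calc lam ≤ ν * ((1 - ic) / (ξ * ν) * Hfun ET (q / ξ)) := h2
        _ ≤ ν * ((1 - ic) / (ξ * ν) * (1 / (ET * (q / ξ + 1)))) := by gcongr
        _ = (1 - ic) / (ET * (ξ + q)) := by field_simp; ring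
    rw [le_div_iff₀ (by positivity)] at h4
    linarith

end Scalar

end PartlySmooth

namespace PartlySmooth

open Filter Topology
open ContinuousLinearMap (adjoint)

/-! ### The dual certificate at the minimizer over `T`. -/

section Certificate

variable {E F : Type*} [NormedAddCommGroup E] [InnerProductSpace ℝ E] [FiniteDimensional ℝ E]
  [NormedAddCommGroup F] [InnerProductSpace ℝ F] [FiniteDimensional ℝ F]

lemma adjoint_comp_starProjection (Φ : E →L[ℝ] F) (V : Submodule ℝ E) (r : F) :
    adjoint (Φ ∘L V.starProjection) r = V.starProjection (adjoint Φ r) := by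
  rw [ContinuousLinearMap.adjoint_comp, ContinuousLinearMap.comp_apply,
    (isSelfAdjoint_starProjection V).adjoint_eq]

variable {Φ : E →L[ℝ] F} {J : E → ℝ} {x₀ z : E} {C : Set E} {f : E → E} {ν μ τ ξ lam : ℝ} {w : F}

lemma IsPSFL.sel_mem_subdifferential (h : IsPSFL J x₀ C f ν μ τ ξ)
    (hz : z ∈ modelSubspace J x₀) : f z ∈ subdifferential J z :=
  intrinsicInterior_subset (h.sel_mem z hz)

/-- Bound on the gauge of the shifted dual certificate of a minimizer over the model subspace. -/
lemma IsPSFL.gauge_certificate_le (h : IsPSFL J x₀ C f ν μ τ ξ) (hz : z ∈ modelSubspace J x₀)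
    (hzν : gauge C (x₀ - z) < ν) (hlam : 0 < lam)
    (hmin : IsMinOn (objective Φ J (Φ x₀ + w) lam) (modelSubspace J x₀) z) {b k : ℝ}
    (hb : ∀ v ∈ modelSubspace J x₀, ‖v‖ ≤ b * gauge C v) (hb0 : 0 < b) (hk0 : 0 < k)
    (hk : ∀ v ∈ parallelSubspace J x₀, gauge (shiftedSubdifferential J x₀ (f x₀)) v ≤ k * ‖v‖) :
    lam⁻¹ • adjoint Φ (Φ x₀ + w - Φ z) - f z ∈ parallelSubspace J x₀ ∧
    gauge (shiftedSubdifferential J x₀ (f x₀)) (lam⁻¹ • adjoint Φ (Φ x₀ + w - Φ z) - f z) ≤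
      irrepresentabilityCriterion Φ J x₀ (f x₀)
      + (k * (‖adjoint (Φ ∘L (parallelSubspace J x₀).starProjection) ∘L
          adjoint (pinv (Φ ∘L (modelSubspace J x₀).starProjection))‖ * b) * μ + τ)
        * gauge C (x₀ - z)
      + k * (‖adjoint (Φ ∘L (parallelSubspace J x₀).starProjection)‖ *
          ‖ContinuousLinearMap.id ℝ F -
            (Φ ∘L (modelSubspace J x₀).starProjection : E →ₗ[ℝ] F).range.starProjection‖)
        * (lam⁻¹ * ‖w‖) := by
  have hx₀ := h.partlySmooth.mem
  have hT : modelSubspace J z = modelSubspace J x₀ := h.nu_stable z hz hzν.le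
  have hS : parallelSubspace J z = parallelSubspace J x₀ := by
    rw [← orthogonal_modelSubspace, hT, orthogonal_modelSubspace]
  have hfz := h.sel_mem_subdifferential hz
  have hfx := h.sel_mem_subdifferential hx₀
  have hτ := h.tau_stable z hz hzν
  have hμ := h.mu_stable z hz hzν
  have heT : minNormVector J z ∈ modelSubspace J x₀ := hT ▸ minNormVector_mem_modelSubspace hfz
  have he₀T : minNormVector J x₀ ∈ modelSubspace J x₀ := minNormVector_mem_modelSubspace hfx
  have hgrad : ∀ v ∈ modelSubspace J x₀,
      inner ℝ (Φ x₀ + w - Φ z) (Φ v) = lam * inner ℝ (minNormVector J z) v := fun v hv =>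
    inner_residual_eq_of_isMinOn h.convex hz hT.ge hfz hmin hlam hv
  have hfin := finiteOn_shiftedSubdifferential (h.sel_mem x₀ hx₀)
  have hconv := convex_shiftedSubdifferential J x₀ (f x₀)
  rw [irrepresentabilityCriterion]
  set T := modelSubspace J x₀ with hTdef
  set S := parallelSubspace J x₀ with hSdef
  set K := shiftedSubdifferential J x₀ (f x₀)
  set A := Φ ∘L T.starProjection
  set B := adjoint (Φ ∘L S.starProjection)
  set G := adjoint (pinv A)
  set P := (A : E →ₗ[ℝ] F).range.starProjection
  set r := Φ x₀ + w - Φ z with hr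
  set u := lam⁻¹ • adjoint Φ r
  have hTS : Tᗮ = S := orthogonal_modelSubspace J x₀
  have hTu : ∀ v ∈ T, inner ℝ u v = inner ℝ (minNormVector J z) v := fun v hv => by
    rw [real_inner_smul_left, ContinuousLinearMap.adjoint_inner_left, hgrad v hv,
      inv_mul_cancel_left₀ hlam.ne']
  have huS : u - f z ∈ S := by
    have h1 : u - minNormVector J z ∈ S := by
      rw [← hTS, Submodule.mem_orthogonal']
      intro v hv
      rw [inner_sub_left, hTu v hv, sub_self]
    have h2 : f z - minNormVector J z ∈ S := hS ▸ sub_minNormVector_mem_parallelSubspace hfz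
    simpa using S.sub_mem h1 h2
  have hA : adjoint A r = lam • minNormVector J z := by
    rw [adjoint_comp_starProjection]
    refine Submodule.eq_starProjection_of_mem_of_inner_eq_zero (T.smul_mem _ heT) (fun v hv => ?_)
      |>.symm ▸ rfl
    rw [inner_sub_left, ContinuousLinearMap.adjoint_inner_left, hgrad v hv, real_inner_smul_left,
      sub_self]
  -- Both `x₀` and `z` lie in `T`, so `r - w = A (x₀ - z)`, and the part of `r` orthogonal to the
  -- range of `A` comes from `w` alone.
  have hrw : r - w ∈ (A : E →ₗ[ℝ] F).range := by
    refine ⟨x₀ - z, ?_⟩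
    have h1 : T.starProjection (x₀ - z) = x₀ - z :=
      Submodule.starProjection_eq_self_iff.2 (T.sub_mem hx₀ hz)
    change Φ (T.starProjection (x₀ - z)) = r - w
    rw [h1, map_sub, hr]
    abel
  have hBS : ∀ q, B q ∈ S := fun q => by
    simp only [B, adjoint_comp_starProjection]
    exact Submodule.starProjection_apply_mem _ _
  -- In order: the vector measured by `IC(x₀)`, the drift of `e`, the noise, the drift of `f`.
  have hdecomp : u - f z = ((B (G (minNormVector J x₀)) - S.starProjection (f x₀))
      + B (G (minNormVector J z - minNormVector J x₀))
      + lam⁻¹ • B (w - P w)) + S.starProjection (f x₀ - f z) := by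
    have h1 : u - f z = lam⁻¹ • B r - S.starProjection (f z) := by
      rw [← Submodule.starProjection_eq_self_iff.2 huS, map_sub, map_smul]
      simp only [B, adjoint_comp_starProjection]
    have h2 : lam⁻¹ • B r = B (G (minNormVector J z)) + lam⁻¹ • B (w - P w) := by
      rw [eq_adjoint_pinv_add A hA hrw, map_add, map_smul, smul_add, inv_smul_smul₀ hlam.ne']
    rw [h1, h2]
    simp only [map_sub]
    abel
  refine ⟨huS, ?_⟩
  have hm1 : B (G (minNormVector J x₀)) - S.starProjection (f x₀) ∈ S :=
    S.sub_mem (hBS _) (Submodule.starProjection_apply_mem _ _)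
  have hm2 : B (G (minNormVector J z - minNormVector J x₀)) ∈ S := hBS _
  have hm3 : lam⁻¹ • B (w - P w) ∈ S := S.smul_mem _ (hBS _)
  have hm4 : S.starProjection (f x₀ - f z) ∈ S := Submodule.starProjection_apply_mem _ _
  have g1 := hfin.gauge_add_le hconv (S.add_mem (S.add_mem hm1 hm2) hm3) hm4
  have g2 := hfin.gauge_add_le hconv (S.add_mem hm1 hm2) hm3
  have g3 := hfin.gauge_add_le hconv hm1 hm2
  have b2 : gauge K (B (G (minNormVector J z - minNormVector J x₀))) ≤
      k * (‖B ∘L G‖ * b) * μ * gauge C (x₀ - z) := by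
    calc _ ≤ k * ‖(B ∘L G) (minNormVector J z - minNormVector J x₀)‖ := hk _ hm2
      _ ≤ k * (‖B ∘L G‖ * ‖minNormVector J z - minNormVector J x₀‖) := by
        gcongr
        exact ContinuousLinearMap.le_opNorm _ _
      _ ≤ k * (‖B ∘L G‖ * (b * (μ * gauge C (x₀ - z)))) := by
        rw [norm_sub_rev]
        gcongr
        exact (hb _ (T.sub_mem he₀T heT)).trans (by gcongr)
      _ = _ := by ring
  have b3 : gauge K (lam⁻¹ • B (w - P w)) ≤
      k * (‖B‖ * ‖ContinuousLinearMap.id ℝ F - P‖) * (lam⁻¹ * ‖w‖) := by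
    calc _ ≤ k * ‖lam⁻¹ • B (w - P w)‖ := hk _ hm3
      _ = k * (lam⁻¹ * ‖B (w - P w)‖) := by
        rw [norm_smul, Real.norm_of_nonneg (inv_nonneg.2 hlam.le)]
      _ ≤ k * (lam⁻¹ * (‖B‖ * (‖ContinuousLinearMap.id ℝ F - P‖ * ‖w‖))) := by
        gcongr
        refine (B.le_opNorm _).trans ?_
        gcongr
        exact (ContinuousLinearMap.id ℝ F - P).le_opNorm w
      _ = _ := by ring
  rw [hdecomp]
  linarith

/-- If the shifted dual certificate has gauge less than one, the minimizer over the model subspace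
is the only minimizer. -/
lemma IsPSFL.isMinOn_iff_eq (h : IsPSFL J x₀ C f ν μ τ ξ) (hz : z ∈ modelSubspace J x₀)
    (hT : modelSubspace J z = modelSubspace J x₀) {y : F} (hlam : 0 < lam)
    (hinj : (Φ : E →ₗ[ℝ] F).ker ⊓ modelSubspace J x₀ = ⊥)
    (hmem : lam⁻¹ • adjoint Φ (y - Φ z) - f z ∈ parallelSubspace J x₀)
    (hlt : gauge (shiftedSubdifferential J z (f z)) (lam⁻¹ • adjoint Φ (y - Φ z) - f z) < 1)
    (v : E) : IsMinOn (objective Φ J y lam) Set.univ v ↔ v = z := by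
  have hS : parallelSubspace J z = parallelSubspace J x₀ := by
    rw [← orthogonal_modelSubspace, hT, orthogonal_modelSubspace]
  have hfz := h.sel_mem_subdifferential hz
  have hfin := finiteOn_shiftedSubdifferential (h.sel_mem z hz)
  have hconv := convex_shiftedSubdifferential J z (f z)
  have h0 := zero_mem_shiftedSubdifferential hfz
  rw [← hS] at hmem
  set u := lam⁻¹ • adjoint Φ (y - Φ z) with hu
  have hsub : ∀ q ∈ shiftedSubdifferential J z (f z), f z + q ∈ subdifferential J z :=
    fun q hq => hq
  refine isMinOn_objective_iff_eq hlam (u := u) ?_ (by rw [hu, smul_inv_smul₀ hlam.ne']) ?_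
    (hT ▸ hinj) v
  · simpa using hsub _ (hfin.mem_of_gauge_lt_one hconv h0 hmem hlt)
  · intro s hs
    set η := 1 - gauge (shiftedSubdifferential J z (f z)) (u - f z)
    have hη : 0 < η := sub_pos.2 hlt
    have hg := gauge_nonneg (s := shiftedSubdifferential J z (f z)) s
    -- The gauge of `u - f z + ε • s` is then at most `1 - ε`.
    set ε := η / (gauge (shiftedSubdifferential J z (f z)) s + 1)
    have hε : 0 < ε := by positivity
    refine ⟨ε, hε, ?_⟩
    have h1 := hfin.gauge_add_le hconv hmem (Submodule.smul_mem _ ε hs)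
    rw [gauge_smul_of_nonneg hε.le, smul_eq_mul] at h1
    have h2 : ε * (gauge (shiftedSubdifferential J z (f z)) s + 1) = η :=
      div_mul_cancel₀ _ (by positivity)
    have h3 : gauge (shiftedSubdifferential J z (f z)) (u - f z + ε • s) < 1 := by
      simp only [η] at h2
      linarith
    have h4 := hsub _ (hfin.mem_of_gauge_lt_one hconv h0
      (Submodule.add_mem _ hmem (Submodule.smul_mem _ ε hs)) h3)
    rwa [← add_assoc, add_sub_cancel] at h4

/-- Comparison of the subdifferential gauges at `z` and `x₀`. -/
lemma IsPSFL.gauge_le_of_gauge_lt (h : IsPSFL J x₀ C f ν μ τ ξ) (hz : z ∈ modelSubspace J x₀)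
    (hzν : gauge C (x₀ - z) < ν) {v : E} (hv : v ∈ parallelSubspace J x₀) :
    gauge (shiftedSubdifferential J z (f z)) v ≤
      (1 + ξ * gauge C (x₀ - z)) * gauge (shiftedSubdifferential J x₀ (f x₀)) v := by
  rcases eq_or_ne v 0 with rfl | hv0
  · simp
  have hpos := (finiteOn_shiftedSubdifferential (h.sel_mem x₀ h.partlySmooth.mem)).gauge_pos
    (isBounded_shiftedSubdifferential h.convex x₀ (f x₀)) hv hv0
  have := h.xi_stable z hz hzν v hv hv0
  rw [div_le_iff₀ hpos] at this
  linarith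

end Certificate

end PartlySmooth

namespace PartlySmooth

open ContinuousLinearMap (adjoint)

/-! ### Choice of the constants and conclusion. -/

section ModelSelection

variable {E F : Type*} [NormedAddCommGroup E] [InnerProductSpace ℝ E] [FiniteDimensional ℝ E]
  [NormedAddCommGroup F] [InnerProductSpace ℝ F] [FiniteDimensional ℝ F]

/-- Norm comparison constants for the gauges of `C` on `T` and of `K` on `Tᗮ`. -/
lemma exists_gauge_constants (C K : Set E) (T : Submodule ℝ E) :
    ∃ a b k : ℝ, 0 < a ∧ 0 < b ∧ 0 < k ∧
      (IsFiniteCoerciveGaugeOn C T →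
        (∀ v ∈ T, gauge C v ≤ a * ‖v‖) ∧ ∀ v ∈ T, ‖v‖ ≤ b * gauge C v) ∧
      (Convex ℝ K → FiniteOn K Tᗮ → ∀ v ∈ Tᗮ, gauge K v ≤ k * ‖v‖) := by
  have h1 : ∃ a b : ℝ, 0 < a ∧ 0 < b ∧ (IsFiniteCoerciveGaugeOn C T →
      (∀ v ∈ T, gauge C v ≤ a * ‖v‖) ∧ ∀ v ∈ T, ‖v‖ ≤ b * gauge C v) := by
    -- The constants must be fixed before `J` is given; the dummy value `1` serves sets that arise
    -- from no admissible `J`.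
    by_cases h : IsFiniteCoerciveGaugeOn C T
    · obtain ⟨a, ha, hav⟩ := FiniteOn.exists_gauge_le_norm h.finite h.convex
      obtain ⟨b, hb, hbv⟩ := exists_norm_le_gauge h.coercive
      exact ⟨a, b, ha, hb, fun _ => ⟨hav, hbv⟩⟩
    · exact ⟨1, 1, one_pos, one_pos, fun h' => absurd h' h⟩
  have h2 : ∃ k : ℝ, 0 < k ∧
      (Convex ℝ K → FiniteOn K Tᗮ → ∀ v ∈ Tᗮ, gauge K v ≤ k * ‖v‖) := by
    by_cases h : Convex ℝ K ∧ FiniteOn K Tᗮ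
    · obtain ⟨k, hk, hkv⟩ := h.2.exists_gauge_le_norm h.1
      exact ⟨k, hk, fun _ _ => hkv⟩
    · exact ⟨1, one_pos, fun hc hf => absurd ⟨hc, hf⟩ h⟩
  obtain ⟨a, b, ha, hb, hab⟩ := h1
  obtain ⟨k, hk, hkv⟩ := h2
  exact ⟨a, b, k, ha, hb, hk, hab, hkv⟩

/-- Drift and noise each use at most a quarter of the slack `1 - ic`; the remaining half absorbs the
product, since `(1 + s)(1 - s) ≤ 1`. -/
lemma one_add_mul_lt_one {ic s t r : ℝ} (hic : ic < 1) (hs : 0 ≤ s)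
    (hst : 4 * (s + t) ≤ 1 - ic) (hr : 4 * r ≤ 1 - ic) : (1 + s) * (ic + t + r) < 1 := by
  have h1 : ic + t + r ≤ 1 - (1 - ic) / 2 - s := by linarith
  calc (1 + s) * (ic + t + r) ≤ (1 + s) * (1 - (1 - ic) / 2 - s) := by gcongr
    _ < 1 := by nlinarith [mul_nonneg hs (sub_pos.2 hic).le]

/-- Robust model selection for partly smooth regularizers. -/
theorem exists_model_selection_constants (Φ : E →L[ℝ] F) (T : Submodule ℝ E)
    (hinj : (Φ : E →ₗ[ℝ] F).ker ⊓ T = ⊥) (C : Set E) (e : E) (K : Set E) :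
    ∃ AT BT DT ET M : ℝ, 0 < AT ∧ 0 < BT ∧ 0 < DT ∧ 0 < ET ∧ 0 < M ∧
      ∀ (J : E → ℝ) (x₀ : E) (f : E → E) (ν μ τ ξ : ℝ), IsPSFL J x₀ C f ν μ τ ξ →
        modelSubspace J x₀ = T → minNormVector J x₀ = e →
        shiftedSubdifferential J x₀ (f x₀) = K →
        irrepresentabilityCriterion Φ J x₀ (f x₀) < 1 →
        ∀ (w : F) (lam : ℝ), 0 < lam →
          AT / (1 - irrepresentabilityCriterion Φ J x₀ (f x₀)) * ‖w‖ ≤ lam →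
          (lam : EReal) ≤ (ν : EReal) * min (BT : EReal)
            (Cconst DT ET (irrepresentabilityCriterion Φ J x₀ (f x₀)) ν μ τ ξ) →
          ∃ xhat : E,
            (∀ x, IsMinOn (objective Φ J (Φ x₀ + w) lam) Set.univ x ↔ x = xhat) ∧
            modelSubspace J xhat = T ∧ ‖x₀ - xhat‖ ≤ M * max ‖w‖ lam := by
  obtain ⟨a, b, k, ha, hb, hk, hab, hkv⟩ := exists_gauge_constants C K T
  obtain ⟨c, hc, hcv⟩ := exists_norm_le_of_ker_inf_eq_bot hinj
  set D₀ := k * (‖adjoint (Φ ∘L Tᗮ.starProjection) ∘L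
    adjoint (pinv (Φ ∘L T.starProjection))‖ * b) with hD₀
  set L := k * (‖adjoint (Φ ∘L Tᗮ.starProjection)‖ * ‖ContinuousLinearMap.id ℝ F -
    (Φ ∘L T.starProjection : E →ₗ[ℝ] F).range.starProjection‖) with hL
  set M := 2 * (‖Φ‖ + ‖e‖) / c ^ 2 + 1 with hM
  have hD₀0 : 0 ≤ D₀ := by positivity
  have hL0 : 0 ≤ L := by positivity
  have hM0 : 0 < M := by positivity
  -- With `Γ(x₀ - z) ≤ a M lam`: in `AT`, the `1` gives `‖w‖ ≤ lam` and `4 L` bounds the noise by a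
  -- quarter of the slack; `BT` gives `Γ(x₀ - z) ≤ ν / 2`; `ET` bounds the drift terms by a quarter.
  -- The `+ 1` in `DT` and in `M` only secures positivity.
  refine ⟨1 + 4 * L, 1 / (2 * (a * M)), D₀ + 1, 4 * (a * M), M, by positivity, by positivity,
    by positivity, by positivity, hM0, ?_⟩
  intro J x₀ f ν μ τ ξ h hT he hK hic w lam hlam hw hup
  have hx₀ := h.partlySmooth.mem
  have hfx := h.sel_mem_subdifferential hx₀
  obtain ⟨hν0, hup1, hup2⟩ := mul_le_of_le_mul_min_Cconst (by positivity) (by positivity) hic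
    h.nu_nonneg h.mu_nonneg h.tau_nonneg h.xi_nonneg hlam hup
  have hfin := finiteOn_shiftedSubdifferential (h.sel_mem x₀ hx₀)
  rw [← orthogonal_modelSubspace] at hfin
  subst hT he hK
  obtain ⟨hav, hbv⟩ := hab h.gauge_spec
  have hk' := hkv (convex_shiftedSubdifferential J x₀ (f x₀)) hfin
  have hic0 : 0 ≤ irrepresentabilityCriterion Φ J x₀ (f x₀) := gauge_nonneg _
  set ic := irrepresentabilityCriterion Φ J x₀ (f x₀)
  have hι : 0 < 1 - ic := sub_pos.2 hic
  rw [div_mul_eq_mul_div, div_le_iff₀ hι] at hw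
  have hLw : 0 ≤ L * ‖w‖ := by positivity
  have hwlam : ‖w‖ ≤ lam := by nlinarith [norm_nonneg w]
  obtain ⟨z, hz, hmin, hdist⟩ := exists_isMinOn_submodule (e := minNormVector J x₀) (w := w)
    h.convex hx₀ (fun v hv => by
      rw [inner_minNormVector hfx hv]
      exact mem_subdifferential_iff_add.1 hfx v) hc hcv hlam
  have hdist' : ‖x₀ - z‖ ≤ M * lam := by
    calc ‖x₀ - z‖ ≤ 2 * (‖Φ‖ * ‖w‖ + lam * ‖minNormVector J x₀‖) / c ^ 2 := hdist
      _ ≤ 2 * (‖Φ‖ * lam + lam * ‖minNormVector J x₀‖) / c ^ 2 := by gcongr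
      _ = 2 * (‖Φ‖ + ‖minNormVector J x₀‖) / c ^ 2 * lam := by ring
      _ ≤ M * lam := by
        gcongr
        exact le_add_of_nonneg_right zero_le_one
  set g := gauge C (x₀ - z) with hg
  have hg0 : 0 ≤ g := gauge_nonneg _
  have hgle : g ≤ a * M * lam := by
    calc g ≤ a * ‖x₀ - z‖ := hav _ (Submodule.sub_mem _ hx₀ hz)
      _ ≤ a * (M * lam) := by gcongr
      _ = a * M * lam := by ring
  have hgν : g < ν := by
    rw [mul_one_div, le_div_iff₀ (by positivity)] at hup1
    linarith
  have hTz := h.nu_stable z hz hgν.le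
  refine ⟨z, ?_, hTz, ?_⟩
  · have hcert := h.gauge_certificate_le (w := w) hz hgν hlam hmin hbv hb hk
      (by rwa [← orthogonal_modelSubspace])
    rw [← orthogonal_modelSubspace, ← hD₀, ← hL, ← hg] at hcert
    obtain ⟨hmem, hle⟩ := hcert
    rw [orthogonal_modelSubspace] at hmem
    refine h.isMinOn_iff_eq hz hTz hlam hinj hmem ?_
    refine (h.gauge_le_of_gauge_lt hz hgν hmem).trans_lt ?_
    have hξ := h.xi_nonneg
    have hμ := h.mu_nonneg
    have hτ := h.tau_nonneg
    refine (mul_le_mul_of_nonneg_left hle (by positivity)).trans_lt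
      (one_add_mul_lt_one hic (by positivity) ?_ ?_)
    · calc 4 * (ξ * g + (D₀ * μ + τ) * g) = 4 * (ξ + (D₀ * μ + τ)) * g := by ring
        _ ≤ 4 * (ξ + ((D₀ + 1) * μ + τ)) * (a * M * lam) := by gcongr; linarith
        _ = 4 * (a * M) * (ξ + ((D₀ + 1) * μ + τ)) * lam := by ring
        _ ≤ 1 - ic := hup2
    · rw [mul_left_comm L, mul_left_comm 4, inv_mul_le_iff₀ hlam]
      nlinarith [norm_nonneg w]
  · rwa [max_eq_right hwlam]

end ModelSelection

end PartlySmooth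

theorem theorem5p1 (N Q : ℕ)
    (Φ : EuclideanSpace ℝ (Fin N) →L[ℝ] EuclideanSpace ℝ (Fin Q))
    (T : Submodule ℝ (EuclideanSpace ℝ (Fin N)))
    (hinj : (Φ : EuclideanSpace ℝ (Fin N) →ₗ[ℝ] EuclideanSpace ℝ (Fin Q)).ker ⊓ T = ⊥)
    (C : Set (EuclideanSpace ℝ (Fin N)))
    (e : EuclideanSpace ℝ (Fin N))
    (K : Set (EuclideanSpace ℝ (Fin N))) :
    -- the constants depend only on `Φ`, `T`, the gauge of `C`, `e_{x₀}` and `∂J(x₀) - f_{x₀}`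
    ∃ AT BT DT ET M : ℝ, 0 < AT ∧ 0 < BT ∧ 0 < DT ∧ 0 < ET ∧ 0 < M ∧
      ∀ (J : EuclideanSpace ℝ (Fin N) → ℝ) (x₀ : EuclideanSpace ℝ (Fin N))
        (f : EuclideanSpace ℝ (Fin N) → EuclideanSpace ℝ (Fin N)) (ν μ τ ξ : ℝ),
        PartlySmooth.IsPSFL J x₀ C f ν μ τ ξ →
        PartlySmooth.modelSubspace J x₀ = T →
        PartlySmooth.minNormVector J x₀ = e →
        PartlySmooth.shiftedSubdifferential J x₀ (f x₀) = K →
        PartlySmooth.irrepresentabilityCriterion Φ J x₀ (f x₀) < 1 →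
        ∀ (w : EuclideanSpace ℝ (Fin Q)) (lam : ℝ), 0 < lam →
          AT / (1 - PartlySmooth.irrepresentabilityCriterion Φ J x₀ (f x₀)) * ‖w‖ ≤ lam →
          (lam : EReal) ≤ (ν : EReal) * min (BT : EReal)
            (PartlySmooth.Cconst DT ET
              (PartlySmooth.irrepresentabilityCriterion Φ J x₀ (f x₀)) ν μ τ ξ) →
          ∃ xhat : EuclideanSpace ℝ (Fin N),
            (∀ x, IsMinOn (PartlySmooth.objective Φ J (Φ x₀ + w) lam) Set.univ x ↔ x = xhat) ∧
            PartlySmooth.modelSubspace J xhat = T ∧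
            ‖x₀ - xhat‖ ≤ M * max ‖w‖ lam := by
  exact PartlySmooth.exists_model_selection_constants Φ T hinj C e K
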